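/- Conventions. A logic program is a finite list of definite clauses, a query is a finite list of atoms. The LD-tree of a program and a query is the SLD-tree built with Prolog's (leftmost) computation rule: a node $\leftarrow r_1,\dots,r_n$ has one child for each program clause of which a variant, standardized apart, has a head that unifies with $r_1$; the child is obtained by replacing $r_1$ by the body of the variant and applying a most general unifier. A node $v=\;\leftarrow s_1,\dots,s_m$ below a node $u$ on the same branch is a direct offspring of $u$ if $s_1$ stems, up to substitution, from a body atom of the clause with which $u$ was resolved; offspring is the transitive closure of direct offspring; a call branch is a path in the tree from a node down to one of its offspring. A symbolic linear norm is given by $\|f(X_1,\dots,X_n)\| = c+\sum_{i=1}^n a_i\|X_i\|$ with non-negative integers $c,a_1,\dots,a_n$ depending only on the function symbol $f/n$, where the norm of a logical variable is an integer variable (so the norm of a term is a linear expression). A term is instantiated enough if its norm is an integer. For a finite family of terms, form the coloured mixed graph with one node per term, black if the term is instantiated enough and white otherwise, with an (undirected) edge between two distinct nodes whose terms have the same norm, and an arc from one black node to another if the norm of the first is larger than that of the second. For a call branch with top node $\leftarrow p_1,\dots,p_m$, bottom node $\leftarrow q_1,\dots,q_n$ and composition $\theta$ of the substitutions along the branch,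 $\alpha_{real}$ of the branch is the query-mapping pair $(\pi,\mu)$, where the query $\pi$ is the predicate of $p_1$ with the mixed graph of the arguments of $p_1$, and the mapping $\mu$ is the mixed graph of the arguments of $p_1\theta$ (the domain, labelled with the predicate of $p_1$) together with those of $q_1$ (the range, labelled with the predicate of $q_1$). If $\pi$ is identical to the range of $\mu$ (same predicate, colours, edges and arcs), the circular variant of $(\pi,\mu)$ is obtained by adding to $\mu$ a circular edge between each range node and the corresponding domain node. A forward positive cycle of it is a cycle in $\mu$ with these circular edges added that contains at least one arc, in which arcs are traversed in their direction, edges in either direction, and circular edges only from the range to the domain. Theorem. Let an LD-tree for a program and a query, and a symbolic linear norm, be given. If every circular variant that can be created from the query-mapping pairs in the image of $\alpha_{real}$ has a forward positive cycle, then the LD-tree is finite, i.e. the query terminates under Prolog's computation rule. -/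

import Mathlib

open FirstOrder

noncomputable section

namespace LogicProg

/-! ### Atoms, clauses, substitutions

Function symbols `f/n` are the elements of `L.Functions n`, predicate symbols `p/n` those of
`L.Relations n`; logical variables are natural numbers, terms are Mathlib's `L.Term ℕ`. -/

/-- An atom `p(t₁,…,tₙ)`. -/
@[ext]
structure Atom (L : Language) where
  arity : ℕ
  pred : L.Relations arity
  args : Fin arity → L.Term ℕ

/-- A definite clause `head :- body`. A fact has an empty body. -/
structure Clause (L : Language) where
  head : Atom L
  body : List (Atom L)

/-- A logic program: a finite list of clauses. -/
abbrev Program (L : Language) := List (Clause L)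

/-- Substitutions, extended to all variables. Their finiteness is required where they are used
as most general unifiers. -/
abbrev Subst (L : Language) := ℕ → L.Term ℕ

namespace Subst

variable {L : Language}

/-- The identity substitution. -/
def id : Subst L := Language.Term.var

/-- Composition: first apply `θ`, then `σ`. -/
def comp (θ σ : Subst L) : Subst L := fun x => (θ x).subst σ

/-- The variables moved by the substitution. -/
def dom (θ : Subst L) : Set ℕ := {x | θ x ≠ Language.Term.var x}

/-- All variables occurring in the bindings `x ↦ θ x` of the substitution. -/
def vars (θ : Subst L) : Set ℕ := θ.dom ∪ ⋃ x ∈ θ.dom, ((θ x).varFinset : Set ℕ)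

end Subst

namespace Atom

variable {L : Language}

/-- Application of a substitution to an atom. -/
def subst (A : Atom L) (θ : Subst L) : Atom L where
  arity := A.arity
  pred := A.pred
  args i := (A.args i).subst θ

/-- The variables of an atom. -/
def vars (A : Atom L) : Set ℕ := ⋃ i, ((A.args i).varFinset : Set ℕ)

end Atom

namespace Clause

variable {L : Language}

/-- Application of a substitution to a clause. -/
def subst (c : Clause L) (θ : Subst L) : Clause L where
  head := c.head.subst θ
  body := c.body.map fun A => A.subst θ

/-- The variables of a clause. -/
def vars (c : Clause L) : Set ℕ := c.head.vars ∪ ⋃ A ∈ c.body, A.vars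

/-- `c'` is a variant of `c`: it is obtained by a renaming of variables. -/
def IsVariant (c' c : Clause L) : Prop :=
  ∃ ρ : Equiv.Perm ℕ, c' = c.subst fun x => Language.Term.var (ρ x)

end Clause

/-- `θ` is a unifier of two atoms. -/
def Unifies {L : Language} (θ : Subst L) (A B : Atom L) : Prop :=
  A.subst θ = B.subst θ

/-- `θ` is a most general unifier of two atoms. -/
structure IsMGU {L : Language} (θ : Subst L) (A B : Atom L) : Prop where
  finite_dom : θ.dom.Finite
  unifies : Unifies θ A B
  most_general : ∀ σ : Subst L, Unifies σ A B → ∃ γ : Subst L, σ = θ.comp γ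

/-! ### LD-trees -/

/-- The address of a node in an LD-tree: the indices of the program clauses used on the way from
the root to the node, the last one first. The root is `[]`, and the child of `v` that results from
resolving with the `i`-th clause is `i :: v`; the ancestors of `v` are the suffixes of `v`. -/
abbrev Address {L : Language} (P : Program L) := List (Fin P.length)

/-- An atom of a goal in the LD-tree, with its "parent": the address of the node whose resolution
introduced the atom (`none` for the atoms of the initial query). -/
structure GoalAtom {L : Language} (P : Program L) where
  atom : Atom L
  parent : Option (Address P)

/-- A goal `← r₁,…,rₙ` whose atoms carry their parents. -/
abbrev Goal {L : Language} (P : Program L) := List (GoalAtom P)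

/-- The goal obtained from `← r₁,…,rₙ` (at address `v`, with tail `rest = r₂,…,rₙ`) by replacing
the leftmost atom by the body of the clause `c` and applying `θ`. -/
def resolvent {L : Language} {P : Program L} (v : Address P) (c : Clause L) (θ : Subst L)
    (rest : Goal P) : Goal P :=
  (c.body.map fun A => ⟨A.subst θ, some v⟩) ++
    rest.map fun r => ⟨r.atom.subst θ, r.parent⟩

/-- An LD-tree for the program `P` and the query `Q`: the SLD-tree in which always the leftmost
atom is selected. The choices of the (standardized apart) clause variants and of the
most general unifiers are part of the data. The values of `goal`, `clause`, `mgu` matter only at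
addresses that belong to `nodes` (and are not the root, for the last two). -/
structure LDTree {L : Language} (P : Program L) (Q : List (Atom L)) where
  /-- the nodes of the tree -/
  nodes : Set (Address P)
  /-- the goal at a node -/
  goal : Address P → Goal P
  /-- the clause variant used in the resolution step that leads to a node -/
  clause : Address P → Clause L
  /-- the substitution associated with the step that leads to a node -/
  mgu : Address P → Subst L
  root_mem : [] ∈ nodes
  goal_root : goal [] = Q.map fun A => ⟨A, none⟩
  /-- A node has a child for exactly those program clauses whose head, renamed apart, unifies
  with the leftmost atom of its goal. -/
  child_mem_iff : ∀ (i : Fin P.length) (v : Address P), i :: v ∈ nodes ↔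
    v ∈ nodes ∧ ∃ r rest, goal v = r :: rest ∧
      ∃ c : Clause L, c.IsVariant (P.get i) ∧ Disjoint c.vars r.atom.vars ∧
        ∃ σ : Subst L, Unifies σ r.atom c.head
  clause_variant : ∀ i v, i :: v ∈ nodes → (clause (i :: v)).IsVariant (P.get i)
  /-- Standardizing apart: the clause variant shares no variable with the query, nor with the
  clause variants and the substitutions used above. -/
  apart_query : ∀ i v, i :: v ∈ nodes → ∀ A ∈ Q, Disjoint (clause (i :: v)).vars A.vars
  apart_above : ∀ i v, i :: v ∈ nodes → ∀ u, u <:+ v → u ≠ [] →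
    Disjoint (clause (i :: v)).vars (clause u).vars ∧
      Disjoint (clause (i :: v)).vars (mgu u).vars
  mgu_spec : ∀ i v, i :: v ∈ nodes → ∀ r rest, goal v = r :: rest →
    IsMGU (mgu (i :: v)) r.atom (clause (i :: v)).head
  goal_child : ∀ i v, i :: v ∈ nodes → ∀ r rest, goal v = r :: rest →
    goal (i :: v) = resolvent v (clause (i :: v)) (mgu (i :: v)) rest

namespace LDTree

variable {L : Language} {P : Program L} {Q : List (Atom L)}

/-- The composition of the substitutions associated with the steps of the path that starts at `u`
and leads down to `l ++ u`. -/
def pathSubst (T : LDTree P Q) (u : Address P) : List (Fin P.length) → Subst L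
  | [] => Subst.id
  | i :: l => (T.pathSubst u l).comp (T.mgu (i :: l ++ u))

/-- The node `v` is a direct offspring of the node `u`: `u` is strictly above `v` on the same
branch, and the first atom of the goal at `v` stems from a body atom of the clause
with which the goal at `u` was resolved. -/
def DirectOffspring (T : LDTree P Q) (v u : Address P) : Prop :=
  u ∈ T.nodes ∧ v ∈ T.nodes ∧ u <:+ v ∧ u ≠ v ∧
    ∃ r rest, T.goal v = r :: rest ∧ r.parent = some u

/-- `v` is an offspring of `u`: transitive closure of the direct offspring relation. -/
def Offspring (T : LDTree P Q) (v u : Address P) : Prop :=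
  Relation.TransGen T.DirectOffspring v u

/-- A call branch: a path from a node `top` down to a node `ext ++ top` that is an offspring
of `top`. -/
structure CallBranch (T : LDTree P Q) where
  top : Address P
  ext : List (Fin P.length)
  offspring : T.Offspring (ext ++ top) top

theorem mem_of_suffix (T : LDTree P Q) {u v : Address P} (h : u <:+ v) (hv : v ∈ T.nodes) :
    u ∈ T.nodes := by
  induction v with
  | nil => rw [List.suffix_nil.1 h]; exact hv
  | cons i v ih =>
    rcases List.suffix_cons_iff.1 h with rfl | h
    · exact hv
    · exact ih h ((T.child_mem_iff i v).1 hv).1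

theorem goal_ne_nil_of_suffix (T : LDTree P Q) {u v : Address P} (h : u <:+ v) (hne : u ≠ v)
    (hv : v ∈ T.nodes) : T.goal u ≠ [] := by
  induction v with
  | nil => exact absurd (List.suffix_nil.1 h) hne
  | cons i v ih =>
    obtain ⟨hv', r, rest, hr, -⟩ := (T.child_mem_iff i v).1 hv
    rcases List.suffix_cons_iff.1 h with h | h
    · exact absurd h hne
    · by_cases huv : u = v
      · rw [huv, hr]; simp
      · exact ih h huv hv'

theorem DirectOffspring.goal_ne_nil {T : LDTree P Q} {v u : Address P}
    (h : T.DirectOffspring v u) : T.goal v ≠ [] ∧ T.goal u ≠ [] := by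
  obtain ⟨-, hv, hs, hne, r, rest, hr, -⟩ := h
  exact ⟨by rw [hr]; simp, T.goal_ne_nil_of_suffix hs hne hv⟩

theorem Offspring.goal_ne_nil {T : LDTree P Q} {v u : Address P}
    (h : T.Offspring v u) : T.goal v ≠ [] ∧ T.goal u ≠ [] := by
  induction h with
  | single h => exact h.goal_ne_nil
  | tail _ h ih => exact ⟨ih.1, h.goal_ne_nil.2⟩

namespace CallBranch

variable {T : LDTree P Q}

/-- The node of the call branch that is farthest from the root. -/
def bottom (B : T.CallBranch) : Address P := B.ext ++ B.top

/-- The first atom `p₁` of the goal at the top of the call branch. -/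
def topAtom (B : T.CallBranch) : Atom L :=
  ((T.goal B.top).head B.offspring.goal_ne_nil.2).atom

/-- The first atom `q₁` of the goal at the bottom of the call branch. -/
def bottomAtom (B : T.CallBranch) : Atom L :=
  ((T.goal B.bottom).head B.offspring.goal_ne_nil.1).atom

/-- The composition `θ` of the substitutions associated with the call branch. -/
def subst (B : T.CallBranch) : Subst L := T.pathSubst B.top B.ext

end CallBranch

end LDTree

/-! ### Symbolic linear norms -/

/-- A linear expression `k + ∑ x, m x * x` with non-negative integer coefficients in the integer
variables that represent the norms of the logical variables, as the pair `(k, m)`. -/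
abbrev LinExpr := ℕ × (ℕ →₀ ℕ)

/-- A symbolic linear norm: for each function symbol `f/n` (constants are the case `n = 0`) the
non-negative integers `c, a₁,…,aₙ` in `‖f(X₁,…,Xₙ)‖ = c + ∑ i, aᵢ * ‖Xᵢ‖`. -/
structure SymbNorm (L : Language) where
  const : ∀ {n : ℕ}, L.Functions n → ℕ
  coeff : ∀ {n : ℕ}, L.Functions n → Fin n → ℕ

namespace SymbNorm

variable {L : Language}

/-- The symbolic norm of a term. -/
def eval (N : SymbNorm L) : L.Term ℕ → LinExpr
  | Language.Term.var x => (0, Finsupp.single x 1)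
  | Language.Term.func f ts => (N.const f, 0) + ∑ i, N.coeff f i • N.eval (ts i)

/-- A term is instantiated enough if its symbolic norm is an integer, i.e. contains no variable. -/
def InstEnough (N : SymbNorm L) (t : L.Term ℕ) : Prop := (N.eval t).2 = 0

end SymbNorm

/-! ### Query-mapping pairs -/

/-- A mixed graph (with undirected edges and directed arcs) whose nodes are black or white. -/
@[ext]
structure MixedGraph (V : Type) where
  black : Set V
  edge : SimpleGraph V
  arc : Digraph V

/-- The mixed graph induced on a part of the nodes, along `f : W → V`. -/
def MixedGraph.comap {V W : Type} (f : W → V) (G : MixedGraph V) : MixedGraph W where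
  black := f ⁻¹' G.black
  edge := G.edge.comap f
  arc := ⟨fun x y => G.arc.Adj (f x) (f y)⟩

/-- A predicate with a mixed graph on its argument positions. -/
structure QueryPattern (L : Language) where
  arity : ℕ
  pred : L.Relations arity
  graph : MixedGraph (Fin arity)

/-- A query-mapping pair `(π, μ)`. The query `π` is a mixed graph on the argument positions of the
predicate `domPred`; the mapping `μ` is a mixed graph on the argument positions of `domPred`
(the domain, `Sum.inl`) and of `ranPred` (the range, `Sum.inr`). -/
structure QMPair (L : Language) where
  domArity : ℕ
  domPred : L.Relations domArity
  ranArity : ℕ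
  ranPred : L.Relations ranArity
  query : MixedGraph (Fin domArity)
  mapping : MixedGraph (Fin domArity ⊕ Fin ranArity)

namespace QMPair

variable {L : Language}

/-- The query `π` of a query-mapping pair, with its predicate. -/
def queryPattern (A : QMPair L) : QueryPattern L := ⟨A.domArity, A.domPred, A.query⟩

/-- The range of the mapping `μ`, with its predicate. -/
def range (A : QMPair L) : QueryPattern L :=
  ⟨A.ranArity, A.ranPred, A.mapping.comap Sum.inr⟩

/-- The query is identical to the range of the mapping, i.e. the circular variant exists. -/
def IsRecursive (A : QMPair L) : Prop := A.queryPattern = A.range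

end QMPair

/-- A query-mapping pair together with a set of circular edges, each between a node of the domain
(first argument) and a node of the range (second argument). -/
structure CircularQMPair (L : Language) extends QMPair L where
  circular : Fin domArity → Fin ranArity → Prop

/-- The circular variant: corresponding nodes in the domain and the range (the same argument
position) are connected by a circular edge. -/
def QMPair.circularVariant {L : Language} (A : QMPair L) (_h : A.IsRecursive) :
    CircularQMPair L where
  toQMPair := A
  circular i j := (i : ℕ) = (j : ℕ)

namespace CircularQMPair

variable {L : Language}

/-- One forward step in the mapping: along an edge in either direction, along an arc in its
direction, or along a circular edge from the range to the domain. -/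
inductive ForwardStep (A : CircularQMPair L) :
    Fin A.domArity ⊕ Fin A.ranArity → Fin A.domArity ⊕ Fin A.ranArity → Prop
  | edge {x y} : A.mapping.edge.Adj x y → ForwardStep A x y
  | arc {x y} : A.mapping.arc.Adj x y → ForwardStep A x y
  | circular {i j} : A.circular i j → ForwardStep A (Sum.inr j) (Sum.inl i)

/-- There is a cycle, all of whose circular edges are traversed from the range to the domain,
that contains an arc: an arc from `x` to `y`, followed by forward steps from `y` back to `x`. -/
def HasForwardPositiveCycle (A : CircularQMPair L) : Prop :=
  ∃ x y, A.mapping.arc.Adj x y ∧ Relation.ReflTransGen A.ForwardStep y x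

end CircularQMPair

/-! ### The shadow mapping -/

/-- The mixed graph of a family of terms: a node is black iff its term is instantiated enough,
edges connect distinct nodes with the same symbolic norm, arcs go from
a node with larger integer norm to a node with smaller integer norm. -/
def SymbNorm.mixedGraph {L : Language} (N : SymbNorm L) {V : Type} (t : V → L.Term ℕ) :
    MixedGraph V where
  black := {x | N.InstEnough (t x)}
  edge :=
    { Adj := fun x y => x ≠ y ∧ N.eval (t x) = N.eval (t y)
      symm := ⟨fun _ _ h => ⟨h.1.symm, h.2.symm⟩⟩
      loopless := ⟨fun _ h => h.1 rfl⟩ }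
  arc := ⟨fun x y => N.InstEnough (t x) ∧ N.InstEnough (t y) ∧ (N.eval (t y)).1 < (N.eval (t x)).1⟩

/-- The "real" query-mapping pair of a call branch: the query is the abstraction of `p₁` with the
constraints between its arguments; the mapping is the mixed graph on the arguments of `p₁θ` (domain)
and of `q₁` (range). -/
def alphaReal {L : Language} {P : Program L} {Q : List (Atom L)} {T : LDTree P Q}
    (N : SymbNorm L) (B : T.CallBranch) : QMPair L where
  domArity := B.topAtom.arity
  domPred := B.topAtom.pred
  ranArity := B.bottomAtom.arity
  ranPred := B.bottomAtom.pred
  query := N.mixedGraph B.topAtom.args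
  mapping := N.mixedGraph (Sum.elim (B.topAtom.subst B.subst).args B.bottomAtom.args)

end LogicProg

end

namespace LogicProg

variable {L : Language}

/-! ### Norms of instances -/

/-! An infinite tree has an infinite branch, and along it an infinite chain of direct offsprings
(`exists_directOffspring_chain`), so any two nodes of the chain bound a call branch. Only finitely
many query-mapping pairs occur (`finite_range_alphaReal`). A weak Ramsey argument thus gives
adjoining call branches that all have the same pair `A` (`exists_callBranch_seq`), and `A` is
recursive because the bottom atom of each branch is the top atom of the next.

A forward positive cycle of `A` can now be followed through the successive copies of its mapping.
Edges preserve the norm and arcs lower it. A circular edge leads from a range argument to its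
instance in the next domain, whose norm is the same once it is an integer (`InstEnough.eval_subst`).
Each round strictly lowers a natural number, so the descent cannot go on forever. -/

theorem SymbNorm.InstEnough.eval_subst {N : SymbNorm L} {t : L.Term ℕ} (h : N.InstEnough t)
    (θ : Subst L) : N.eval (t.subst θ) = N.eval t := by
  induction t with
  | var x => simp [SymbNorm.InstEnough, SymbNorm.eval] at h
  | func f ts ih =>
    -- Coefficients are non-negative, so variables cannot cancel: an argument that still has them in
    -- its norm must have weight zero.
    have h' : ∀ i, N.coeff f i = 0 ∨ N.InstEnough (ts i) := by
      simpa [SymbNorm.InstEnough, SymbNorm.eval, Prod.snd_sum, or_comm] using h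
    simp only [Language.Term.subst, SymbNorm.eval]
    congr 1
    refine Finset.sum_congr rfl fun i _ => ?_
    rcases h' i with h0 | h0
    · simp [h0]
    · rw [ih i h0]

theorem SymbNorm.InstEnough.subst {N : SymbNorm L} {t : L.Term ℕ} (h : N.InstEnough t)
    (θ : Subst L) : N.InstEnough (t.subst θ) := by
  unfold SymbNorm.InstEnough
  rw [h.eval_subst θ]
  exact h

/-! ### Finiteness of the set of query-mapping pairs -/

/-- The predicate of an atom, with its arity. -/
def Atom.symbol (A : Atom L) : Σ n, L.Relations n := ⟨A.arity, A.pred⟩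

theorem Atom.args_eq_of_eq {A B : Atom L} (h : A = B) {i : Fin A.arity} {j : Fin B.arity}
    (hij : (i : ℕ) = j) : A.args i = B.args j := by
  subst h
  rw [Fin.ext hij]

instance MixedGraph.finite {V : Type} [Finite V] : Finite (MixedGraph V) :=
  Finite.of_injective
    (fun G : MixedGraph V => (G.black, G.edge.Adj, G.arc.Adj)) fun G H h => by
      simp only [Prod.mk.injEq] at h
      exact MixedGraph.ext h.1 (SimpleGraph.ext h.2.1) (Digraph.ext h.2.2)

/-- Fixing the two predicates fixes the arities, which leaves finitely many graphs. The restriction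
to `S` matters since `L` may have infinitely many predicates. -/
theorem QMPair.finite_of_symbols {S : Set (Σ n, L.Relations n)} (hS : S.Finite) :
    {A : QMPair L | (⟨A.domArity, A.domPred⟩ : Σ n, L.Relations n) ∈ S ∧
      (⟨A.ranArity, A.ranPred⟩ : Σ n, L.Relations n) ∈ S}.Finite := by
  have := hS.to_subtype
  let F : (Σ p : S × S, MixedGraph (Fin p.1.1.1) ×
      MixedGraph (Fin p.1.1.1 ⊕ Fin p.2.1.1)) → QMPair L :=
    fun x => ⟨x.1.1.1.1, x.1.1.1.2, x.1.2.1.1, x.1.2.1.2, x.2.1, x.2.2⟩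
  refine (Set.finite_range F).subset ?_
  rintro ⟨n, p, m, q, g, h⟩ ⟨h1, h2⟩
  exact ⟨⟨(⟨⟨n, p⟩, h1⟩, ⟨⟨m, q⟩, h2⟩), (g, h)⟩, rfl⟩

namespace LDTree

variable {P : Program L} {Q : List (Atom L)} {T : LDTree P Q}

/-- The predicates of the query and of the clause bodies. -/
def symbols (P : Program L) (Q : List (Atom L)) : Set (Σ n, L.Relations n) :=
  {s | s ∈ Q.map Atom.symbol} ∪ {s | s ∈ P.flatMap fun c => c.body.map Atom.symbol}

theorem finite_symbols : (symbols P Q).Finite :=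
  (List.finite_toSet _).union (List.finite_toSet _)

/-- Renaming and substitution never change a predicate. -/
theorem symbol_mem_symbols {v : Address P} (hv : v ∈ T.nodes) {r : GoalAtom P}
    (hr : r ∈ T.goal v) : r.atom.symbol ∈ symbols P Q := by
  induction v generalizing r with
  | nil =>
    rw [T.goal_root, List.mem_map] at hr
    obtain ⟨A, hA, rfl⟩ := hr
    exact Or.inl (List.mem_map_of_mem hA)
  | cons i v ih =>
    obtain ⟨hv', s, rest, hs, -⟩ := (T.child_mem_iff i v).1 hv
    rw [T.goal_child i v hv s rest hs, resolvent, List.mem_append] at hr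
    rcases hr with hr | hr
    · obtain ⟨ρ, hρ⟩ := T.clause_variant i v hv
      rw [hρ] at hr
      simp only [Clause.subst, List.map_map, List.mem_map, Function.comp] at hr
      obtain ⟨A, hA, rfl⟩ := hr
      refine Or.inr (List.mem_flatMap.2 ⟨P.get i, List.get_mem _ _, ?_⟩)
      exact List.mem_map.2 ⟨A, hA, rfl⟩
    · obtain ⟨s', hs', rfl⟩ := List.mem_map.1 hr
      exact ih hv' (r := s') (hs ▸ List.mem_cons_of_mem _ hs')

theorem Offspring.mem {u v : Address P} (h : T.Offspring v u) : v ∈ T.nodes ∧ u ∈ T.nodes := by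
  induction h with
  | single h => exact ⟨h.2.1, h.1⟩
  | tail _ h ih => exact ⟨ih.1, h.1⟩

theorem Offspring.suffix {u v : Address P} (h : T.Offspring v u) : u <:+ v := by
  induction h with
  | single h => exact h.2.2.1
  | tail _ h ih => exact h.2.2.1.trans ih

theorem finite_range_alphaReal (N : SymbNorm L) :
    (Set.range (alphaReal (T := T) N)).Finite := by
  refine (QMPair.finite_of_symbols (finite_symbols (P := P) (Q := Q))).subset ?_
  rintro _ ⟨B, rfl⟩
  exact ⟨symbol_mem_symbols B.offspring.mem.2 (List.head_mem _),
    symbol_mem_symbols B.offspring.mem.1 (List.head_mem _)⟩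

/-! ### Infinite branches -/

/-- König's lemma for LD-trees. -/
theorem exists_infinite_branch (h : T.nodes.Infinite) :
    ∃ b : ℕ → Address P, ∀ n, b n ∈ T.nodes ∧ ∃ i, b (n + 1) = i :: b n := by
  let Big : Address P → Prop := fun v => {w ∈ T.nodes | v <:+ w}.Infinite
  have step : ∀ v, Big v → ∃ w, Big w ∧ ∃ i, w = i :: v := by
    intro v hv
    suffices ∃ i, Big (i :: v) from this.elim fun i hi => ⟨_, hi, i, rfl⟩
    by_contra! hcon
    -- The subtree at `v` is `v` together with the subtrees at its children, whose indices range
    -- over the finitely many clauses.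
    refine hv (((Set.finite_singleton v).union
      (Set.finite_iUnion fun i => Set.not_infinite.1 (hcon i))).subset ?_)
    rintro w ⟨hw, t, rfl⟩
    rcases List.eq_nil_or_concat t with rfl | ⟨t, i, rfl⟩
    · exact Or.inl rfl
    · exact Or.inr (Set.mem_iUnion.2 ⟨i, hw, t, by simp⟩)
  have root : Big [] := by simpa [Big] using h
  choose! next hnext using step
  let b : ℕ → Address P := fun n => Nat.rec [] (fun _ v => next v) n
  have hb : ∀ n, Big (b n) := fun n => by
    induction n with
    | zero => exact root
    | succ n ih => exact (hnext _ ih).1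
  refine ⟨b, fun n => ⟨?_, (hnext _ (hb n)).2⟩⟩
  obtain ⟨w, hw, hs⟩ := (hb n).nonempty
  exact T.mem_of_suffix hs hw

/-- The parents of the atoms of a goal. -/
def parents (T : LDTree P Q) (v : Address P) : List (Option (Address P)) :=
  (T.goal v).map GoalAtom.parent

/-- Substitutions do not affect parents, so the list of parents behaves as a stack: pop one entry,
push copies of the current node. -/
theorem exists_parents_eq {i : Fin P.length} {v : Address P} (h : i :: v ∈ T.nodes) :
    ∃ p rest k, T.parents v = p :: rest ∧
      T.parents (i :: v) = List.replicate k (some v) ++ rest := by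
  obtain ⟨-, r, rest, hr, -⟩ := (T.child_mem_iff i v).1 h
  refine ⟨r.parent, rest.map GoalAtom.parent, (T.clause (i :: v)).body.length, ?_, ?_⟩
  · simp [parents, hr]
  · simp [parents, T.goal_child i v h r rest hr, resolvent, Function.comp_def]

/-- In an infinite branch there is an infinite chain of direct offsprings: the nodes from which
on the goals never become shorter. -/
theorem exists_directOffspring_chain {b : ℕ → Address P}
    (hb : ∀ n, b n ∈ T.nodes ∧ ∃ i, b (n + 1) = i :: b n) :
    ∃ w : ℕ → Address P, ∀ n, T.DirectOffspring (w (n + 1)) (w n) := by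
  have hstep : ∀ n, ∃ p rest k, T.parents (b n) = p :: rest ∧
      T.parents (b (n + 1)) = List.replicate k (some (b n)) ++ rest := by
    intro n
    obtain ⟨i, hi⟩ := (hb n).2
    have := (hb (n + 1)).1
    rw [hi] at this ⊢
    exact exists_parents_eq this
  have hsuff : ∀ m k, b m <:+ b (m + k) := by
    intro m k
    induction k with
    | zero => exact List.suffix_refl _
    | succ k ih =>
      obtain ⟨i, hi⟩ := (hb (m + k)).2
      rw [← add_assoc, hi]
      exact ih.trans (List.suffix_cons _ _)
  have hlen : ∀ n, (b n).length = (b 0).length + n := by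
    intro n
    induction n with
    | zero => rfl
    | succ n ih =>
      obtain ⟨i, hi⟩ := (hb n).2
      rw [hi, List.length_cons, ih, add_assoc]
  let h : ℕ → ℕ := fun n => (T.parents (b n)).length
  -- `n'` is the first index from `n` on at which the goal length attains its minimum over all
  -- indices from `n` on.
  have hmin : ∀ n, ∃ n', n ≤ n' ∧ (∀ m, n ≤ m → h n' ≤ h m) ∧
      ∀ m, n ≤ m → m < n' → h n' < h m := by
    intro n
    have hex : ∃ t m, n ≤ m ∧ h m = t := ⟨_, n, le_rfl, rfl⟩
    classical
    have hex' := Nat.find_spec hex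
    obtain ⟨h1, h2⟩ := Nat.find_spec hex'
    have h3 : ∀ m, n ≤ m → h (Nat.find hex') ≤ h m := fun m hm => by
      rw [h2]
      exact Nat.find_min' hex ⟨m, hm, rfl⟩
    refine ⟨Nat.find hex', h1, h3, fun m hm hlt => ?_⟩
    refine lt_of_le_of_ne (h3 m hm) fun he => ?_
    exact Nat.find_min hex' hlt ⟨hm, he ▸ h2⟩
  -- A bottom part of the stack survives as long as the stack is strictly higher, because each pop
  -- then removes an entry above it.
  have hkeep : ∀ m k (s : List (Option (Address P))), s <:+ T.parents (b m) →
      (∀ j, m ≤ j → j < m + k → s.length < h j) → s <:+ T.parents (b (m + k)) := by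
    intro m k s hs hlt
    induction k with
    | zero => exact hs
    | succ k ih =>
      have ih := ih fun j h1 h2 => hlt j h1 (by omega)
      obtain ⟨p, rest, l, e1, e2⟩ := hstep (m + k)
      rw [← add_assoc, e2]
      have hl := hlt (m + k) (by omega) (by omega)
      rw [e1] at ih
      rcases List.suffix_cons_iff.1 ih with rfl | ih
      · simp [h, e1] at hl
      · exact ih.trans (List.suffix_append _ _)
  let Good : ℕ → Prop := fun n => ∀ m, n ≤ m → h n ≤ h m
  have next : ∀ n, Good n → ∃ n', Good n' ∧ T.DirectOffspring (b n') (b n) := by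
    intro n hn
    obtain ⟨n', hle, hmin', hlt⟩ := hmin (n + 1)
    obtain ⟨d, rfl⟩ := Nat.exists_eq_add_of_le hle
    refine ⟨n + 1 + d, fun m hm => hmin' m (hle.trans hm), (hb _).1, (hb _).1, ?_, ?_, ?_⟩
    · rw [add_assoc]; exact hsuff _ _
    · intro e
      have := congrArg List.length e
      rw [hlen n, hlen (n + 1 + d)] at this
      omega
    · obtain ⟨p, rest, k, e1, e2⟩ := hstep n
      obtain ⟨p', rest', -, e1', -⟩ := hstep (n + 1 + d)
      -- As `n` is good, the stack at the next minimum is higher than what remained after the pop at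
      -- `n`, so it still contains an entry pushed there.
      have hge : rest.length < h (n + 1 + d) := by
        have := hn (n + 1 + d) (by omega)
        simp only [h, e1, List.length_cons] at this ⊢
        omega
      have hle' := hmin' (n + 1) le_rfl
      -- These lowest entries are never popped before the first minimum and by length are the whole
      -- stack there. Its top entry is thus one of the copies of `b n`.
      have hsub : (T.parents (b (n + 1))).drop (h (n + 1) - h (n + 1 + d)) <:+
          T.parents (b (n + 1 + d)) := by
        refine hkeep _ _ _ (List.drop_suffix _ _) fun j h1 h2 => ?_
        have := hlt j h1 h2
        rw [List.length_drop]
        change h (n + 1) - _ < _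
        omega
      have heq := hsub.eq_of_length (by
        rw [List.length_drop]
        change h (n + 1) - _ = h (n + 1 + d)
        omega)
      have hk : h (n + 1) = k + rest.length := by simp [h, e2]
      have hp : p' = some (b n) := by
        rw [e2, List.drop_append_of_le_length (by rw [List.length_replicate]; omega),
          List.drop_replicate, e1'] at heq
        obtain ⟨l, hl⟩ : ∃ l, k - (h (n + 1) - h (n + 1 + d)) = l + 1 :=
          Nat.exists_eq_succ_of_ne_zero (by omega)
        rw [hl, List.replicate_succ, List.cons_append] at heq
        exact (List.cons.inj heq).1.symm
      subst hp
      obtain ⟨r, rest'', hr, hr', -⟩ := List.map_eq_cons_iff.1 e1'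
      exact ⟨r, rest'', hr, hr'⟩
  obtain ⟨n₀, -, hn₀, -⟩ := hmin 0
  choose! nx hnx using next
  let s : ℕ → ℕ := fun k => Nat.rec n₀ (fun _ n => nx n) k
  have hs : ∀ k, Good (s k) := fun k => by
    induction k with
    | zero => exact fun m _ => hn₀ m (Nat.zero_le _)
    | succ k ih => exact (hnx _ ih).1
  exact ⟨fun k => b (s k), fun k => (hnx _ (hs k)).2⟩

namespace CallBranch

theorem bottomAtom_eq_topAtom {B C : T.CallBranch} (h : B.bottom = C.top) :
    B.bottomAtom = C.topAtom := by
  simp only [topAtom, bottomAtom, h]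

end CallBranch

end LDTree

/-! ### A Ramsey argument -/

/-- If the pairs `i < j` are coloured with finitely many colours, then the consecutive pairs of
some subsequence have the same colour. -/
theorem exists_subseq_consecutive_eq {α : Type*} {S : Set α} (hS : S.Finite) (c : ℕ → ℕ → α)
    (hc : ∀ i j, i < j → c i j ∈ S) :
    ∃ (a : α) (g : ℕ → ℕ), StrictMono g ∧ ∀ n, c (g n) (g (n + 1)) = a := by
  induction S, hS using Set.Finite.induction_on generalizing c with
  | empty => exact absurd (hc 0 1 one_pos) (Set.notMem_empty _)
  | @insert a S _ _ ih =>
    -- Either consecutive pairs of a subsequence have colour `a`, or on a subsequence no pair at all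
    -- has it, and one colour is eliminated.
    obtain ⟨g, hg | hg⟩ := exists_increasing_or_nonincreasing_subseq' (fun i j => c i j = a) id
    · exact ⟨a, g, g.strictMono, hg⟩
    · obtain ⟨a', g', hg', h⟩ := ih (fun i j => c (g i) (g j)) fun i j hij =>
        (hc _ _ (g.strictMono hij)).resolve_left (hg i j hij)
      exact ⟨a', g ∘ g', g.strictMono.comp hg', h⟩

/-! ### Forward positive cycles exclude infinite descents -/

/-- The predicate of an atom, with the mixed graph of its arguments. -/
def SymbNorm.pattern (N : SymbNorm L) (A : Atom L) : QueryPattern L :=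
  ⟨A.arity, A.pred, N.mixedGraph A.args⟩

theorem SymbNorm.comap_mixedGraph (N : SymbNorm L) {V W : Type} {f : W → V}
    (hf : Function.Injective f) (t : V → L.Term ℕ) :
    (N.mixedGraph t).comap f = N.mixedGraph (t ∘ f) := by
  refine MixedGraph.ext rfl (SimpleGraph.ext ?_) rfl
  ext x y
  simp [MixedGraph.comap, SymbNorm.mixedGraph, hf.ne_iff]

theorem range_alphaReal {P : Program L} {Q : List (Atom L)} {T : LDTree P Q} (N : SymbNorm L)
    (B : T.CallBranch) : (alphaReal N B).range = N.pattern B.bottomAtom := by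
  have := N.comap_mixedGraph Sum.inr_injective
    (Sum.elim (B.topAtom.subst B.subst).args B.bottomAtom.args)
  simp only [QMPair.range, SymbNorm.pattern, alphaReal]
  congr 1

/-- Re-indexes the arguments by the arities of the common pair `A`, so that different call branches
give families over the same types. -/
theorem alphaReal_eq {P : Program L} {Q : List (Atom L)} {T : LDTree P Q} {N : SymbNorm L}
    {B : T.CallBranch} {A : QMPair L} (h : alphaReal N B = A) :
    ∃ (d : Fin A.domArity → L.Term ℕ) (r : Fin A.ranArity → L.Term ℕ),
      A.mapping = N.mixedGraph (Sum.elim d r) ∧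
      (⟨A.domArity, A.domPred, d⟩ : Atom L) = B.topAtom.subst B.subst ∧
      (⟨A.ranArity, A.ranPred, r⟩ : Atom L) = B.bottomAtom := by
  subst h
  exact ⟨_, _, rfl, rfl, rfl⟩

/-- No infinite sequence of instances of a circular variant with a forward positive cycle exists in
which each domain is an instance of the preceding range. -/
theorem not_hasForwardPositiveCycle_of_seq {N : SymbNorm L} {A : QMPair L} (hA : A.IsRecursive)
    (d : ℕ → Fin A.domArity → L.Term ℕ) (r : ℕ → Fin A.ranArity → L.Term ℕ) (θ : ℕ → Subst L)
    (hmap : ∀ n, A.mapping = N.mixedGraph (Sum.elim (d n) (r n)))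
    (hinst : ∀ n (i : Fin A.domArity) (j : Fin A.ranArity), (i : ℕ) = (j : ℕ) → d (n + 1) i = (r n j).subst (θ n)) :
    ¬ (A.circularVariant hA).HasForwardPositiveCycle := by
  rintro ⟨x, y, hxy, hyx⟩
  change A.mapping.arc.Adj x y at hxy
  let t : ℕ → Fin A.domArity ⊕ Fin A.ranArity → L.Term ℕ := fun n => Sum.elim (d n) (r n)
  have harc : ∀ n u v, A.mapping.arc.Adj u v → N.InstEnough (t n u) ∧ N.InstEnough (t n v) ∧
      (N.eval (t n v)).1 < (N.eval (t n u)).1 := fun n u v h => by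
    rw [hmap n] at h; exact h
  have hedge : ∀ n u v, A.mapping.edge.Adj u v → N.eval (t n u) = N.eval (t n v) :=
    fun n u v h => by rw [hmap n] at h; exact h.2
  -- The path is lifted to the sequence of copies: `m` advances by one at each circular edge and
  -- otherwise stays.
  have hpath : ∀ z, Relation.ReflTransGen (A.circularVariant hA).ForwardStep y z → ∀ n, ∃ m,
      N.InstEnough (t m z) ∧ (N.eval (t m z)).1 ≤ (N.eval (t n y)).1 := by
    intro z hz n
    induction hz with
    | refl => exact ⟨n, (harc n x y hxy).2.1, le_rfl⟩
    | tail _ hstep ih =>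
      obtain ⟨m, hm, hle⟩ := ih
      cases hstep with
      | edge h =>
        have he := hedge m _ _ h
        exact ⟨m, by rw [SymbNorm.InstEnough, ← he]; exact hm, he ▸ hle⟩
      | arc h =>
        obtain ⟨-, h2, h3⟩ := harc m _ _ h
        exact ⟨m, h2, h3.le.trans hle⟩
      | @circular i j h =>
        have hm' : N.InstEnough (r m j) := hm
        -- Forwardness is used here: from range to domain a term only becomes more instantiated, so
        -- blackness and norm carry over.
        have he : d (m + 1) i = (r m j).subst (θ m) := hinst m i j h
        have h1 : N.InstEnough (d (m + 1) i) := he ▸ hm'.subst _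
        have h2 : N.eval (d (m + 1) i) = N.eval (r m j) := he ▸ hm'.eval_subst _
        exact ⟨m + 1, h1, (congrArg Prod.fst h2).trans_le hle⟩
  -- The arc from `x` to `y` makes one round strictly decreasing.
  have hdesc : ∀ k n, (N.eval (t n x)).1 ≠ k := by
    intro k
    induction k using Nat.strong_induction_on with
    | _ k ih =>
      intro n hn
      obtain ⟨m, -, hm⟩ := hpath x hyx n
      exact ih _ (hm.trans_lt ((harc n x y hxy).2.2.trans_eq hn)) m rfl
  exact hdesc _ 0 rfl

/-- Pairs of nodes in the offspring chain are coloured by `alphaReal` of the call branch between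
them. Equal colours on consecutive pairs suffice, since only adjoining branches are compared. -/
theorem LDTree.exists_callBranch_seq {P : Program L} {Q : List (Atom L)} {T : LDTree P Q}
    (N : SymbNorm L) (h : T.nodes.Infinite) :
    ∃ (A : QMPair L) (B : ℕ → T.CallBranch), (∀ n, alphaReal N (B n) = A) ∧
      ∀ n, (B n).bottomAtom = (B (n + 1)).topAtom := by
  obtain ⟨b, hb⟩ := exists_infinite_branch h
  obtain ⟨w, hw⟩ := exists_directOffspring_chain hb
  have hoff : ∀ i j, i < j → T.Offspring (w j) (w i) := by
    intro i j hij
    induction j, hij using Nat.le_induction with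
    | base => exact .single (hw i)
    | succ j _ ih => exact .head (hw j) ih
  have hB : ∀ i j, i < j → ∃ B : T.CallBranch, B.top = w i ∧ B.bottom = w j := by
    intro i j hij
    obtain ⟨e, he⟩ := (hoff i j hij).suffix
    exact ⟨⟨w i, e, he ▸ hoff i j hij⟩, rfl, he⟩
  have : Nonempty T.CallBranch := ⟨(hB 0 1 one_pos).choose⟩
  choose! B hB using hB
  obtain ⟨A, g, hg, hA⟩ := exists_subseq_consecutive_eq (finite_range_alphaReal (T := T) N)
    (fun i j => alphaReal N (B i j)) fun i j _ => ⟨_, rfl⟩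
  refine ⟨A, fun n => B (g n) (g (n + 1)), hA, fun n => CallBranch.bottomAtom_eq_topAtom ?_⟩
  rw [(hB _ _ (hg n.lt_succ_self)).2, (hB _ _ (hg (n + 1).lt_succ_self)).1]

end LogicProg

theorem theorem4 {L : FirstOrder.Language} (P : LogicProg.Program L)
    (Q : List (LogicProg.Atom L)) (T : LogicProg.LDTree P Q) (N : LogicProg.SymbNorm L)
    (hcyc : ∀ A ∈ Set.range (LogicProg.alphaReal (T := T) N), ∀ hA : A.IsRecursive,
      (A.circularVariant hA).HasForwardPositiveCycle) :
    T.nodes.Finite := by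
  by_contra hinf
  obtain ⟨A, B, hBA, hB⟩ := LogicProg.LDTree.exists_callBranch_seq N hinf
  have hrec : A.IsRecursive := by
    have h1 : A.queryPattern = N.pattern (B 1).topAtom := by rw [← hBA 1]; rfl
    have h0 : A.range = N.pattern (B 0).bottomAtom := by
      rw [← hBA 0, LogicProg.range_alphaReal]
    rw [LogicProg.QMPair.IsRecursive, h1, h0, hB 0]
  choose d r hmap hd hr using fun n => LogicProg.alphaReal_eq (hBA n)
  refine LogicProg.not_hasForwardPositiveCycle_of_seq hrec d r (fun n => (B (n + 1)).subst) hmap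
    (fun n i j hij => ?_) (hcyc A ⟨B 0, hBA 0⟩ hrec)
  -- The domain of branch `n + 1` is its top atom under its substitution, and that top atom is the
  -- range atom of branch `n`.
  have h : (⟨A.domArity, A.domPred, d (n + 1)⟩ : LogicProg.Atom L) =
      LogicProg.Atom.subst ⟨A.ranArity, A.ranPred, r n⟩ (B (n + 1)).subst := by
    rw [hd (n + 1), hr n, hB n]
  exact LogicProg.Atom.args_eq_of_eq h (i := i) (j := j) hij
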